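/- An $\infty$-pseudo-metric space is a set $X$ with a symmetric function $\rho : X\times X\to[0,\infty]$ satisfying $\rho(x,x)=0$ and the triangle inequality; $B(x,r)=\{y : \rho(x,y)<r\}$. - $X$ has *finite asymptotic dimension* if there is an integer $n\ge 0$ such that for every real $r>0$ one can write $X=Y_0\cup\dots\cup Y_n$, where each $Y_i$ is the union of a family of subsets whose diameters are bounded by a common real number and such that points belonging to different members of the family are at distance at least $r$. - For $r>0$ and $A\subseteq X$, a *scale-$r$-chain in $A$* is a finite sequence $x_0,\dots,x_n$ of points of $A$ with $B(x_i,r)\cap B(x_{i+1},r)\neq\emptyset$ for $0\le i<n$ (balls taken in $X$). The scale-$r$-component of $x$ in $A$ is the set of all $y$ which can be joined to $x$ by a scale-$r$-chain in $A$. The set $A$ is *of scale-$r$-dimension $0$* if the diameters of its scale-$r$-components have a finite supremum. - $X$ has *Asymptotic Property C* if for every sequence $(r_i)_{i\ge1}$ of positive real numbers there are a natural number $m$ and a decomposition $X=\bigcup_{i=1}^m X_i$ such that each $X_i$ is of scale-$r_i$-dimension $0$. **Corollary 7.12.** Let $D$ be an infinite countable set and let $\alpha : D\to[0,\infty)$ have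 limit infinity at infinity, i.e. for each $M>0$ there is a finite $E\subseteq D$ with $\alpha(d)>M$ for all $d\in D\setminus E$. Let $(X_d,\rho_d)$, $d\in D$, be $\infty$-pseudo-metric spaces, each of finite asymptotic dimension, and suppose that there is $c>0$ such that every $X_d$ is $c$-discrete, i.e. $\rho_d(x,y)\ge c$ for all $x\ne y$ in $X_d$. Then the reduced product $(\times_{d\in D}X_d,\rho_\alpha)$, i.e. the full cartesian product $\prod_{d\in D}X_d$ with the $\infty$-pseudo-metric $$\rho_\alpha(u,v)=\sum_{d\in D}\alpha(d)\cdot\rho_d(u(d),v(d))\in[0,\infty]\qquad(0\cdot\infty=0),$$ has Asymptotic Property C. -/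

import Mathlib

open scoped ENNReal NNReal

/-! An `∞`-pseudo-metric space is Mathlib's `PseudoEMetricSpace`: a symmetric `[0, ∞]`-valued
distance vanishing on the diagonal and satisfying the triangle inequality. -/

section Coarse

variable {X : Type*} [PseudoEMetricSpace X]

/-- The scale-`r`-component of `x` in `A`: all points `y` that can be joined to `x` by a
scale-`r`-chain in `A`, i.e. a sequence `z 0 = y, …, z n = x` of points of `A` such that the open
`r`-balls (of the ambient space `X`) about consecutive points intersect. It is empty if `x ∉ A`. -/
def scaleComponent (r : ℝ) (A : Set X) (x : X) : Set X :=
  {y | ∃ (n : ℕ) (z : ℕ → X), (∀ i ≤ n, z i ∈ A) ∧ z 0 = y ∧ z n = x ∧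
    ∀ i < n, (Metric.eball (z i) (ENNReal.ofReal r) ∩
      Metric.eball (z (i + 1)) (ENNReal.ofReal r)).Nonempty}

/-- `A` is of scale-`r`-dimension `0`: the diameters of its scale-`r`-components have a finite
supremum. -/
def ScaleDimZero (r : ℝ) (A : Set X) : Prop :=
  ⨆ x : X, Metric.ediam (scaleComponent r A x) < ∞

/-- A family of subsets is uniformly bounded: some real number bounds all the diameters. -/
def UniformlyBoundedFamily (𝒰 : Set (Set X)) : Prop :=
  ∃ S : ℝ, 0 < S ∧ ∀ U ∈ 𝒰, Metric.ediam U ≤ ENNReal.ofReal S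

/-- A family of subsets is `r`-disjoint: points belonging to different members are at distance at
least `r`. -/
def DisjointFamily (r : ℝ) (𝒰 : Set (Set X)) : Prop :=
  ∀ U ∈ 𝒰, ∀ V ∈ 𝒰, U ≠ V → ∀ x ∈ U, ∀ y ∈ V, ENNReal.ofReal r ≤ edist x y

variable (X)

/-- The asymptotic dimension of `X` is at most `n`: for every `r > 0` the space is a union of
subsets `Y 0, …, Y n`, each of which is the union of a uniformly bounded and `r`-disjoint
family. -/
def AsdimLE (n : ℕ) : Prop :=
  ∀ r : ℝ, 0 < r → ∃ Y : Fin (n + 1) → Set X, ⋃ i, Y i = Set.univ ∧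
    ∀ i, ∃ 𝒰 : Set (Set X), Y i = ⋃₀ 𝒰 ∧ UniformlyBoundedFamily 𝒰 ∧ DisjointFamily r 𝒰

/-- `X` has finite asymptotic dimension. -/
def FiniteAsdim : Prop := ∃ n : ℕ, AsdimLE X n

/-- `X` has Asymptotic Property C: for every sequence of positive reals `r 0, r 1, …` the space is
a finite union of subsets `Y 0, …, Y (m - 1)` with `Y i` of scale-`r i`-dimension `0`. -/
def AsymptoticPropertyC : Prop :=
  ∀ r : ℕ → ℝ, (∀ i, 0 < r i) → ∃ (m : ℕ) (Y : Fin m → Set X), ⋃ i, Y i = Set.univ ∧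
    ∀ i : Fin m, ScaleDimZero (r i) (Y i)

/-- `X` is `c`-discrete: distinct points are at distance at least `c`. -/
def IsDiscreteAtScale (c : ℝ) : Prop :=
  ∀ x y : X, x ≠ y → ENNReal.ofReal c ≤ edist x y

end Coarse

section ReducedProduct

/-- `α : D → [0, ∞)` has limit infinity at infinity: for each `M > 0` one has `α d > M` for all `d`
outside some finite subset of `D`. -/
def HasLimitInfinity {D : Type*} (α : D → ℝ≥0) : Prop :=
  ∀ M : ℝ≥0, 0 < M → ∃ E : Finset D, ∀ d ∉ E, M < α d

/-- The underlying set of the reduced product is the full cartesian product; this type synonym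
carries the distance depending on the weights `α`. -/
def ReducedProduct {D : Type*} (X : D → Type*) (_α : D → ℝ≥0) : Type _ := (d : D) → X d

variable {D : Type*} {X : D → Type*} {α : D → ℝ≥0} [∀ d, PseudoEMetricSpace (X d)]

/-- The distance of the reduced product, `ρ_α(u, v) = ∑ d, α d * ρ_d (u d, v d)`, a sum in `[0, ∞]`
(with `0 * ∞ = 0`). -/
noncomputable instance ReducedProduct.instPseudoEMetricSpace :
    PseudoEMetricSpace (ReducedProduct X α) where
  edist u v := ∑' d, (α d : ℝ≥0∞) * edist (u d) (v d)
  edist_self u := by simp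
  edist_comm u v := by simp only [edist_comm]
  edist_triangle u v w := by
    rw [← ENNReal.tsum_add]
    refine ENNReal.tsum_le_tsum fun d => ?_
    rw [← mul_add]
    exact mul_le_mul_right (edist_triangle _ _ _) _

end ReducedProduct

/-! By discreteness and `α → ∞`, a short step moves only finitely many coordinates of nonzero
weight: those in `F₀` at the first scale `r`, those in `F₀ ∪ G` at a large scale `R`. Colouring all
of `F₀ ∪ G` would need a number of sets depending on `R`. Instead, each colour pattern `c` on `G` is
assigned its own gaps in the `F₀` coordinates (`AsdimLE.exists_gap_coloring`). A point avoiding the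
gaps of its own pattern goes into the first set: `r`-steps freeze `G`, hence `c`, and the gaps
confine the `F₀` coordinates. The other points are sorted by the gap they meet and their `F₀`
colours, data independent of `R`. Gaps of different patterns are far apart, so an `R`-step within
such a set preserves `c`, hence every colour and every cell. -/

/-! ### Bounding scale components -/

theorem edist_lt_of_eball_inter_nonempty {X : Type*} [PseudoEMetricSpace X] {r : ℝ≥0∞} {x y : X}
    (h : (Metric.eball x r ∩ Metric.eball y r).Nonempty) : edist x y < 2 * r := by
  obtain ⟨z, hx, hy⟩ := h
  rw [Metric.mem_eball'] at hx
  rw [Metric.mem_eball] at hy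
  calc edist x y ≤ edist x z + edist z y := edist_triangle _ _ _
    _ < r + r := ENNReal.add_lt_add hx hy
    _ = 2 * r := (two_mul r).symm

/-- If a relation starting at `x` propagates along short steps inside `A` and controls the
distance to `x`, then the scale components of `A` are uniformly bounded. -/
theorem scaleDimZero_of_invariant {X : Type*} [PseudoEMetricSpace X] {r : ℝ} {A : Set X}
    (S : ℝ≥0) (T : X → X → Prop) (hrefl : ∀ x ∈ A, T x x)
    (hstep : ∀ x ∈ A, ∀ y ∈ A, ∀ z ∈ A, T x y → edist y z < 2 * ENNReal.ofReal r → T x z)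
    (hbound : ∀ x y, T x y → edist x y ≤ S) : ScaleDimZero r A := by
  have hT : ∀ x, ∀ y ∈ scaleComponent r A x, edist x y ≤ S := by
    rintro x y ⟨n, z, hz, rfl, rfl, hball⟩
    -- The chain ends at the base point, so it is followed backwards.
    have key : ∀ k ≤ n, T (z n) (z (n - k)) := by
      intro k
      induction k with
      | zero => intro _; exact hrefl _ (hz n le_rfl)
      | succ k ih =>
        intro hk
        refine hstep _ (hz n le_rfl) (z (n - k)) (hz _ (by omega)) _ (hz _ (by omega))
          (ih (by omega)) ?_
        have h := edist_lt_of_eball_inter_nonempty (hball (n - (k + 1)) (by omega))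
        rw [edist_comm]
        rwa [show n - (k + 1) + 1 = n - k by omega] at h
    have h := key n le_rfl
    rw [Nat.sub_self] at h
    exact hbound _ _ h
  refine lt_of_le_of_lt (b := ((S + S : ℝ≥0) : ℝ≥0∞)) (iSup_le fun x => ?_) ENNReal.coe_lt_top
  refine Metric.ediam_le fun y hy z hz => ?_
  calc edist y z ≤ edist y x + edist x z := edist_triangle _ _ _
    _ ≤ S + S := add_le_add (by rw [edist_comm]; exact hT x y hy) (hT x z hz)
    _ = ((S + S : ℝ≥0) : ℝ≥0∞) := by push_cast; rfl

/-! ### Colourings and gaps in a single factor -/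

theorem AsdimLE.exists_coloring {X : Type*} [PseudoEMetricSpace X] {n : ℕ} (h : AsdimLE X n)
    {a : ℝ≥0} (ha : a ≠ 0) {T : ℝ≥0} (hT : 0 < T) :
    ∃ (col : X → Fin (n + 1)) (cell : X → Set X) (S : ℝ≥0),
      (∀ x y, col x = col y → (a : ℝ≥0∞) * edist x y < T → cell x = cell y) ∧
      ∀ x y, cell x = cell y → (a : ℝ≥0∞) * edist x y ≤ S := by
  obtain ⟨Y, hY, hU⟩ := h ((T / a : ℝ≥0) : ℝ) (by positivity)
  choose U hYU hbdd hdisj using hU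
  choose S hS hdiam using hbdd
  have hcol : ∀ x, ∃ i, x ∈ Y i := fun x => by
    have hx : x ∈ ⋃ i, Y i := hY ▸ Set.mem_univ x
    simpa using hx
  choose col hcol using hcol
  have hcell : ∀ x, ∃ V ∈ U (col x), x ∈ V := fun x => by
    have hx := hcol x
    rw [hYU] at hx
    simpa using hx
  choose cell hcellU hcell using hcell
  refine ⟨col, cell, a * ∑ i, (S i).toNNReal, fun x y hxy hlt => ?_, fun x y hxy => ?_⟩
  · by_contra hne
    have hle := hdisj (col x) _ (hcellU x) _ (hxy ▸ hcellU y) hne x (hcell x) y (hcell y)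
    rw [ENNReal.ofReal_coe_nnreal] at hle
    refine absurd hlt (not_lt.2 ?_)
    calc (T : ℝ≥0∞) = (a : ℝ≥0∞) * ((T / a : ℝ≥0) : ℝ≥0∞) := by
          rw [← ENNReal.coe_mul, mul_div_cancel₀ _ ha]
      _ ≤ _ := by gcongr
  · push_cast
    gcongr
    calc edist x y ≤ Metric.ediam (cell x) :=
          Metric.edist_le_ediam_of_mem (hcell x) (hxy ▸ hcell y)
      _ ≤ ((S (col x)).toNNReal : ℝ≥0∞) := hdiam _ _ (hcellU x)
      _ ≤ _ := Finset.single_le_sum (f := fun i => ((S i).toNNReal : ℝ≥0∞))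
          (fun _ _ => zero_le) (Finset.mem_univ _)

/-- A space of asymptotic dimension at most `n` can be coloured by `n + 1` colours with bounded
cells that are separated within each colour; moreover there are, for each colour, `N` mutually
separated gaps such that avoiding the `c`-th gaps of all colours confines chains. -/
theorem AsdimLE.exists_gap_coloring {X : Type*} [PseudoEMetricSpace X] {n : ℕ} (h : AsdimLE X n)
    {a : ℝ≥0} (ha : a ≠ 0) {Q : ℝ≥0} (hQ : 0 < Q) (N : ℕ) :
    ∃ (col : X → Fin (n + 1)) (cell : X → Set X) (S : ℝ≥0) (gap : Fin (n + 1) → ℕ → Set X)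
      (P : ℕ → X → X → Prop),
      (∀ x y, col x = col y → (a : ℝ≥0∞) * edist x y < Q → cell x = cell y) ∧
      (∀ x y, cell x = cell y → (a : ℝ≥0∞) * edist x y ≤ S) ∧
      (∀ i c c' x y, x ∈ gap i c → y ∈ gap i c' → (a : ℝ≥0∞) * edist x y < Q → c = c') ∧
      (∀ c x, P c x x) ∧ (∀ c < N, ∀ x y, P c x y → (a : ℝ≥0∞) * edist x y ≤ S) ∧
      ∀ c < N, ∀ x y z, P c x y → (a : ℝ≥0∞) * edist y z < Q → (∀ i, z ∉ gap i c) → P c x z := by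
  -- Two points within `(2c+1)Q` of the ends of a `Q`-step are less than `(4c+3)Q` apart; cells of
  -- one colour must be separated by this for all `c < N`.
  obtain ⟨col, cell, S, hsep, hbdd⟩ :=
    h.exists_coloring ha (T := (4 * N + 3) * Q) (by positivity)
  have tri : ∀ x y z : X, (a : ℝ≥0∞) * edist x z ≤ a * edist x y + a * edist y z := by
    intro x y z
    rw [← mul_add]
    gcongr
    exact edist_triangle _ _ _
  let f : Fin (n + 1) → X → ℝ≥0∞ := fun i x => a * Metric.infEDist x {y | col y = i}
  have hf : ∀ i x y, f i y ≤ f i x + a * edist x y := by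
    intro i x y
    simp only [f]
    rw [← mul_add, edist_comm x y]
    gcongr
    exact Metric.infEDist_le_infEDist_add_edist
  have hf_lt : ∀ i x (t : ℝ≥0∞), f i x < t → ∃ y, col y = i ∧ (a : ℝ≥0∞) * edist x y < t := by
    intro i x t ht
    have ha' : (a : ℝ≥0∞) ≠ 0 := by exact_mod_cast ha
    have ht' : Metric.infEDist x {y | col y = i} < t / a := by
      rw [ENNReal.lt_div_iff_mul_lt (Or.inl ha') (Or.inl ENNReal.coe_ne_top), mul_comm]
      exact ht
    obtain ⟨y, hy, hlt⟩ := Metric.infEDist_lt_iff.1 ht'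
    refine ⟨y, hy, ?_⟩
    rwa [ENNReal.lt_div_iff_mul_lt (Or.inl ha') (Or.inl ENNReal.coe_ne_top), mul_comm] at hlt
  have hf_le : ∀ x y, f (col y) x ≤ a * edist x y := by
    intro x y
    simp only [f]
    gcongr
    exact Metric.infEDist_le_edist_of_mem rfl
  have hle : ∀ k : ℕ, ∀ m : ℕ, k ≤ m → ((k * Q : ℝ≥0) : ℝ≥0∞) ≤ ((m * Q : ℝ≥0) : ℝ≥0∞) := by
    intro k m hkm
    gcongr
  -- The gap is a shell of width `Q` around colour class `i`; shells for different `c` are `Q`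
  -- apart. `P c x` is the `(2c+1)Q`-neighbourhood of the cell of `x`, which a `Q`-step cannot leave
  -- without landing in the shell or near another cell of that colour.
  refine ⟨col, cell, S + ((2 * N + 1 : ℕ) : ℝ≥0) * Q,
    fun i c => {x | (((2 * c + 1 : ℕ) * Q : ℝ≥0) : ℝ≥0∞) ≤ f i x ∧
      f i x < (((2 * c + 2 : ℕ) * Q : ℝ≥0) : ℝ≥0∞)},
    fun c x z => ∃ w, col w = col x ∧ cell w = cell x ∧
      (a : ℝ≥0∞) * edist z w < (((2 * c + 1 : ℕ) * Q : ℝ≥0) : ℝ≥0∞), ?_, ?_, ?_, ?_, ?_, ?_⟩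
  · intro x y hxy hlt
    refine hsep x y hxy (hlt.trans_le ?_)
    have : Q ≤ (4 * N + 3) * Q := le_mul_of_one_le_left hQ.le (by
      have : (0 : ℝ≥0) ≤ 4 * N := zero_le
      calc (1 : ℝ≥0) ≤ 0 + 3 := by norm_num
        _ ≤ _ := by gcongr)
    exact_mod_cast this
  · intro x y hxy
    refine (hbdd x y hxy).trans ?_
    exact_mod_cast le_self_add
  · have key : ∀ i c c' x y, f i x < (((2 * c + 2 : ℕ) * Q : ℝ≥0) : ℝ≥0∞) →
        (((2 * c' + 1 : ℕ) * Q : ℝ≥0) : ℝ≥0∞) ≤ f i y → (a : ℝ≥0∞) * edist x y < Q →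
        ¬ c < c' := by
      intro i c c' x y hx hy hlt hcc
      have h1 : f i y < (((2 * c + 3 : ℕ) * Q : ℝ≥0) : ℝ≥0∞) := by
        calc f i y ≤ f i x + a * edist x y := hf i x y
          _ < (((2 * c + 2 : ℕ) * Q : ℝ≥0) : ℝ≥0∞) + Q := ENNReal.add_lt_add hx hlt
          _ = _ := by rw [← ENNReal.coe_add]; congr 1; push_cast; ring
      exact absurd (hy.trans_lt h1) (not_lt.2 (hle _ _ (by omega)))
    intro i c c' x y hx hy hlt
    refine le_antisymm (not_lt.1 ?_) (not_lt.1 ?_)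
    · exact key i c' c y x hy.2 hx.1 (by rwa [edist_comm])
    · exact key i c c' x y hx.2 hy.1 hlt
  · intro c x
    refine ⟨x, rfl, rfl, ?_⟩
    rw [edist_self, mul_zero]
    exact_mod_cast (by positivity : (0 : ℝ≥0) < (2 * c + 1 : ℕ) * Q)
  · rintro c hc x y ⟨w, -, hw, hlt⟩
    calc (a : ℝ≥0∞) * edist x y ≤ a * edist x w + a * edist w y := tri _ _ _
      _ ≤ S + (((2 * N + 1 : ℕ) * Q : ℝ≥0) : ℝ≥0∞) := by
        refine add_le_add (hbdd _ _ hw.symm) ?_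
        rw [edist_comm]
        exact hlt.le.trans (hle _ _ (by omega))
      _ = _ := by push_cast; rfl
  · rintro c hc x y z ⟨w, hwcol, hwcell, hlt⟩ hyz hgap
    have h1 : f (col x) z < (((2 * c + 2 : ℕ) * Q : ℝ≥0) : ℝ≥0∞) := by
      calc f (col x) z ≤ f (col x) y + a * edist y z := hf _ _ _
        _ ≤ a * edist y w + a * edist y z := by gcongr; rw [← hwcol]; exact hf_le _ _
        _ < (((2 * c + 1 : ℕ) * Q : ℝ≥0) : ℝ≥0∞) + Q := ENNReal.add_lt_add hlt hyz
        _ = _ := by rw [← ENNReal.coe_add]; congr 1; push_cast; ring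
    have h2 : f (col x) z < (((2 * c + 1 : ℕ) * Q : ℝ≥0) : ℝ≥0∞) := by
      by_contra hge
      exact hgap (col x) ⟨not_lt.1 hge, h1⟩
    obtain ⟨w', hw'col, hw'⟩ := hf_lt _ _ _ h2
    refine ⟨w', hw'col, ?_, hw'⟩
    rw [← hwcell]
    refine hsep _ _ (hw'col.trans hwcol.symm) ?_
    calc (a : ℝ≥0∞) * edist w' w ≤ a * edist w' z + a * edist z w := tri _ _ _
      _ ≤ a * edist w' z + (a * edist z y + a * edist y w) := by gcongr; exact tri _ _ _
      _ = a * edist z w' + (a * edist y z + a * edist y w) := by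
        rw [edist_comm w' z, edist_comm z y]
      _ < (((2 * c + 1 : ℕ) * Q : ℝ≥0) : ℝ≥0∞) + (Q + (((2 * c + 1 : ℕ) * Q : ℝ≥0) : ℝ≥0∞)) :=
        ENNReal.add_lt_add hw' (ENNReal.add_lt_add hyz hlt)
      _ = (((4 * c + 3 : ℕ) * Q : ℝ≥0) : ℝ≥0∞) := by
        rw [← ENNReal.coe_add, ← ENNReal.coe_add]; congr 1; push_cast; ring
      _ ≤ (((4 * N + 3 : ℕ) * Q : ℝ≥0) : ℝ≥0∞) := hle _ _ (by omega)
      _ = _ := by push_cast; rfl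

/-! ### Reduction to two scales -/

/-- To verify Asymptotic Property C it suffices to find, with a number of sets determined by the
first scale, one set of dimension `0` at the first scale and others at an arbitrarily large one. -/
theorem asymptoticPropertyC_of_option {X : Type*} [PseudoEMetricSpace X]
    (h : ∀ r : ℝ, 0 < r → ∃ (ι : Type) (_ : Finite ι), ∀ R : ℝ, r ≤ R →
      ∃ (Z₀ : Set X) (Z : ι → Set X), (∀ x, x ∈ Z₀ ∨ ∃ j, x ∈ Z j) ∧ ScaleDimZero r Z₀ ∧
        ∀ j, ∀ s ≤ R, ScaleDimZero s (Z j)) : AsymptoticPropertyC X := by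
  intro r hr
  obtain ⟨ι, _, hι⟩ := h (r 0) (hr 0)
  obtain ⟨m, ⟨e⟩⟩ := Finite.exists_equiv_fin ι
  have hle : ∀ i < m + 1, r i ≤ ∑ i ∈ Finset.range (m + 1), r i := fun i hi =>
    Finset.single_le_sum (fun i _ => (hr i).le) (Finset.mem_range.2 hi)
  obtain ⟨Z₀, Z, hcov, h₀, hZ⟩ := hι (∑ i ∈ Finset.range (m + 1), r i) (hle 0 (by omega))
  refine ⟨m + 1, Fin.cons Z₀ fun i => Z (e.symm i), ?_, fun i => ?_⟩
  · refine Set.eq_univ_of_forall fun x => Set.mem_iUnion.2 ?_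
    rcases hcov x with hx | ⟨j, hj⟩
    · exact ⟨0, hx⟩
    · exact ⟨(e j).succ, by simpa using hj⟩
  · refine Fin.cases ?_ (fun i => ?_) i
    · exact h₀
    · exact hZ _ _ (hle _ (by simp))

/-! ### Short steps in the reduced product -/

namespace ReducedProduct

variable {D : Type*} {X : D → Type*} {α : D → ℝ≥0} [∀ d, PseudoEMetricSpace (X d)]

theorem mul_edist_le_edist (u v : ReducedProduct X α) (d : D) :
    (α d : ℝ≥0∞) * edist (u d) (v d) ≤ edist u v :=
  ENNReal.le_tsum (f := fun d => (α d : ℝ≥0∞) * edist (u d) (v d)) d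

theorem edist_le_sum {u v : ReducedProduct X α} {F : Finset D} {S : D → ℝ≥0}
    (hF : ∀ d ∈ F, (α d : ℝ≥0∞) * edist (u d) (v d) ≤ S d)
    (hFc : ∀ d ∉ F, α d = 0 ∨ u d = v d) : edist u v ≤ ((∑ d ∈ F, S d : ℝ≥0) : ℝ≥0∞) := by
  have h : edist u v = ∑ d ∈ F, (α d : ℝ≥0∞) * edist (u d) (v d) := by
    refine tsum_eq_sum fun d hd => ?_
    rcases hFc d hd with h | h <;> simp [h]
  rw [h]
  push_cast
  exact Finset.sum_le_sum hF

/-- Short steps change only finitely many of the coordinates of nonzero weight. -/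
theorem exists_finset_of_edist_lt (hα : HasLimitInfinity α) {c : ℝ} (hc : 0 < c)
    (hX : ∀ d, IsDiscreteAtScale (X d) c) {Q : ℝ≥0} (hQ : 0 < Q) :
    ∃ F : Finset D, (∀ d ∈ F, α d ≠ 0) ∧
      ∀ u v : ReducedProduct X α, edist u v < Q → ∀ d ∉ F, α d = 0 ∨ u d = v d := by
  classical
  lift c to ℝ≥0 using hc.le
  have hc' : 0 < c := by exact_mod_cast hc
  -- Beyond `E`, changing one coordinate already costs at least `α d * c ≥ Q`.
  obtain ⟨E, hE⟩ := hα (Q / c) (by positivity)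
  refine ⟨E.filter fun d => α d ≠ 0, fun d hd => (Finset.mem_filter.1 hd).2,
    fun u v huv d hd => ?_⟩
  by_contra! hne
  have hdE : d ∉ E := fun hdE => hd (Finset.mem_filter.2 ⟨hdE, hne.1⟩)
  refine absurd ((mul_edist_le_edist u v d).trans_lt huv) (not_lt.2 ?_)
  have h1 := hX d _ _ hne.2
  rw [ENNReal.ofReal_coe_nnreal] at h1
  calc (Q : ℝ≥0∞) = ((Q / c * c : ℝ≥0) : ℝ≥0∞) := by rw [div_mul_cancel₀ _ hc'.ne']
    _ ≤ ((α d * c : ℝ≥0) : ℝ≥0∞) := by gcongr; exact (hE d hdE).le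
    _ ≤ α d * edist (u d) (v d) := by push_cast; gcongr

end ReducedProduct

/-! ### The decomposition -/

theorem corollary7p12 {D : Type*} [Infinite D] [Countable D]
    (X : D → Type*) [∀ d, PseudoEMetricSpace (X d)]
    (α : D → ℝ≥0) (hα : HasLimitInfinity α)
    (hasdim : ∀ d, FiniteAsdim (X d))
    (hdiscrete : ∃ c : ℝ, 0 < c ∧ ∀ d, IsDiscreteAtScale (X d) c) :
    AsymptoticPropertyC (ReducedProduct X α) := by
  classical
  obtain ⟨δ, hδ, hX⟩ := hdiscrete
  choose n hn using hasdim
  refine asymptoticPropertyC_of_option fun r hr => ?_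
  have hr' : 0 < r.toNNReal := Real.toNNReal_pos.2 hr
  obtain ⟨F₀, hF₀, hmove₀⟩ :=
    ReducedProduct.exists_finset_of_edist_lt hα hδ hX (Q := 2 * r.toNNReal) (by positivity)
  let κ := F₀.equivFin.symm
  refine ⟨(Σ k : Fin F₀.card, Fin (n (κ k) + 1)) × (∀ k : Fin F₀.card, Fin (n (κ k) + 1)),
    inferInstance, fun R hrR => ?_⟩
  have hR' : 0 < R.toNNReal := Real.toNNReal_pos.2 (hr.trans_le hrR)
  obtain ⟨F, hF, hmove⟩ :=
    ReducedProduct.exists_finset_of_edist_lt hα hδ hX (Q := 2 * R.toNNReal) (by positivity)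
  let G : Finset D := F \ F₀
  have hG : ∀ d ∈ G, α d ≠ 0 ∧ d ∉ F₀ := fun d hd =>
    ⟨hF d (Finset.mem_sdiff.1 hd).1, (Finset.mem_sdiff.1 hd).2⟩
  -- One gap index per colour pattern on `G`.
  obtain ⟨N, ⟨e⟩⟩ := Finite.exists_equiv_fin (∀ d : G, Fin (n d + 1))
  have hgap := fun d : {d // α d ≠ 0} =>
    (hn d).exists_gap_coloring d.2 (Q := 2 * R.toNNReal) (by positivity) N
  choose col cell S gap P hcell hbdd hsep hPrefl hPbdd hPstep using hgap
  -- The default `0` is never used: the sums run over coordinates of nonzero weight.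
  let S' : D → ℝ≥0 := fun d => if hd : α d ≠ 0 then S ⟨d, hd⟩ else 0
  have hS' : ∀ d (hd : α d ≠ 0), S' d = S ⟨d, hd⟩ := fun d hd => dif_pos hd
  let γ : ReducedProduct X α → ∀ d : G, Fin (n d + 1) := fun u d =>
    col ⟨d, (hG d d.2).1⟩ (u d)
  have hcoe : ∀ s ≤ R, 2 * ENNReal.ofReal s ≤ ((2 * R.toNNReal : ℝ≥0) : ℝ≥0∞) := by
    intro s hs
    push_cast
    exact mul_le_mul_right (ENNReal.ofReal_le_ofReal hs) 2
  have hγ : ∀ u v : ReducedProduct X α, (∀ d ∉ F₀, α d = 0 ∨ u d = v d) → γ u = γ v := by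
    intro u v huv
    funext d
    simp only [γ]
    rw [(huv d (hG d d.2).2).resolve_left (hG d d.2).1]
  refine ⟨{u | ∀ d (hd : d ∈ F₀) i, u d ∉ gap ⟨d, hF₀ d hd⟩ i (e (γ u))},
    fun j => {u | u (κ j.1.1) ∈ gap ⟨κ j.1.1, hF₀ _ (κ j.1.1).2⟩ j.1.2 (e (γ u)) ∧
      ∀ k, col ⟨κ k, hF₀ _ (κ k).2⟩ (u (κ k)) = j.2 k}, ?_, ?_, ?_⟩
  · intro u
    by_cases hu : ∀ d (hd : d ∈ F₀) i, u d ∉ gap ⟨d, hF₀ d hd⟩ i (e (γ u))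
    · exact Or.inl hu
    · push Not at hu
      obtain ⟨d, hd, i, hi⟩ := hu
      obtain ⟨k, hk⟩ := κ.surjective ⟨d, hd⟩
      obtain rfl : (κ k : D) = d := by rw [hk]
      exact Or.inr ⟨⟨⟨k, i⟩, fun k => col ⟨κ k, hF₀ _ (κ k).2⟩ (u (κ k))⟩, hi, fun _ => rfl⟩
  · refine scaleDimZero_of_invariant (∑ d ∈ F₀, S' d)
      (fun u v => (∀ d (hd : d ∈ F₀), P ⟨d, hF₀ d hd⟩ (e (γ u)) (u d) (v d)) ∧
        ∀ d ∉ F₀, α d = 0 ∨ u d = v d) ?_ ?_ ?_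
    · exact fun u _ => ⟨fun d hd => hPrefl _ _ _, fun d _ => Or.inr rfl⟩
    · rintro u - v - w hw ⟨huv, huv'⟩ hvw
      have huw' : ∀ d ∉ F₀, α d = 0 ∨ u d = w d := fun d hd => by
        rcases huv' d hd with h | h
        · exact Or.inl h
        · rw [h]
          exact hmove₀ v w hvw d hd
      refine ⟨fun d hd => ?_, huw'⟩
      refine hPstep _ _ (e (γ u)).2 _ _ _ (huv d hd) ?_ fun i => ?_
      · exact (ReducedProduct.mul_edist_le_edist v w d).trans_lt (hvw.trans_le (hcoe r hrR))
      · rw [hγ u w huw']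
        exact hw d hd i
    · rintro u v ⟨huv, huv'⟩
      refine ReducedProduct.edist_le_sum (fun d hd => ?_) huv'
      rw [hS' d (hF₀ d hd)]
      exact hPbdd _ _ (e (γ u)).2 _ _ (huv d hd)
  · intro j s hs
    have hFne : ∀ d ∈ F₀ ∪ G, α d ≠ 0 := fun d hd =>
      (Finset.mem_union.1 hd).elim (hF₀ d) fun h => (hG d h).1
    refine scaleDimZero_of_invariant (∑ d ∈ F₀ ∪ G, S' d)
      (fun u v => (∀ d (hd : d ∈ F₀ ∪ G), cell ⟨d, hFne d hd⟩ (u d) = cell ⟨d, hFne d hd⟩ (v d)) ∧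
        ∀ d ∉ F₀ ∪ G, α d = 0 ∨ u d = v d) ?_ ?_ ?_
    · exact fun u _ => ⟨fun d hd => rfl, fun d _ => Or.inr rfl⟩
    · rintro u - v hv w hw ⟨huv, huv'⟩ hvw
      have hvw' := hvw.trans_le (hcoe s hs)
      have hlt : ∀ d, (α d : ℝ≥0∞) * edist (v d) (w d) < ((2 * R.toNNReal : ℝ≥0) : ℝ≥0∞) :=
        fun d => (ReducedProduct.mul_edist_le_edist v w d).trans_lt hvw'
      -- Both points lie in gaps of the same coordinate and colour, and these are separated for
      -- distinct indices.
      have hγvw : γ v = γ w :=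
        e.injective (Fin.ext (hsep _ _ _ _ _ _ hv.1 hw.1 (hlt _)))
      refine ⟨fun d hd => (huv d hd).trans (hcell _ _ _ ?_ (hlt d)), fun d hd => ?_⟩
      · rcases Finset.mem_union.1 hd with h | h
        · obtain ⟨k, hk⟩ := κ.surjective ⟨d, h⟩
          obtain rfl : (κ k : D) = d := by rw [hk]
          exact (hv.2 k).trans (hw.2 k).symm
        · exact congrFun hγvw ⟨d, h⟩
      · rcases huv' d hd with h | h
        · exact Or.inl h
        · rw [h]
          refine hmove v w hvw' d fun hdF => hd ?_
          by_cases h0 : d ∈ F₀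
          · exact Finset.mem_union_left _ h0
          · exact Finset.mem_union_right _ (Finset.mem_sdiff.2 ⟨hdF, h0⟩)
    · rintro u v ⟨huv, huv'⟩
      refine ReducedProduct.edist_le_sum (fun d hd => ?_) huv'
      rw [hS' d (hFne d hd)]
      exact hbdd _ _ _ (huv d hd)
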